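/- For integers $k,n\ge 0$ let $Q_k=\{0,1,\dots,k-1\}$ and let $Q_k^n$ be the set of $n$-tuples over $Q_k$; for $k\le m$ regard $Q_k^n\subseteq Q_m^n$. A one-dimensional face of $Q_k^n$ is a set of the form $\{(a_1,\dots,a_{i-1},x,a_{i+1},\dots,a_n) : x\in Q_k\}$ with $1\le i\le n$ and $(a_1,\dots,a_n)\in Q_k^n$. A set $M\subseteq Q_k^n$ is an MDS code (with distance $2$) if it meets every one-dimensional face in exactly one element. A set $B\subseteq Q_k^n$ is a latin bitrade if it meets every one-dimensional face in $0$ or $2$ elements; it is bipartite if the graph on $B$, in which two vertices are adjacent when they differ in exactly one position, is bipartite. A latin bitrade $B$ is embedded in an MDS code $M_1$ if there is an MDS code $M_2$ in the same cube with $B=M_1\triangle M_2$. Proposition. For every bipartite latin bitrade $B\subseteq Q_k^n$ there are an integer $m\ge k$ and an MDS code $M\subseteq Q_m^n$ such that $B$, regarded as a subset of $Q_m^n$, is embedded in $M$. -/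

import Mathlib

open scoped symmDiff

namespace LatinBitrade

/-- The `k`-ary `n`-dimensional hypercube `Q_k^n`, where `Q_k = {0, …, k - 1}`. -/
abbrev Cube (k n : ℕ) : Type := Fin n → Fin k

/-- The one-dimensional face of direction `i` through the vertex `a`. -/
def oneFace {k n : ℕ} (a : Cube k n) (i : Fin n) : Set (Cube k n) :=
  Set.range fun x : Fin k => Function.update a i x

/-- `M` is a `t`-fold MDS code (with distance 2): every one-dimensional face meets it
in exactly `t` vertices. -/
def IsMultipleMDSCode {k n : ℕ} (t : ℕ) (M : Set (Cube k n)) : Prop :=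
  ∀ (a : Cube k n) (i : Fin n), (M ∩ oneFace a i).ncard = t

/-- An MDS code is a `1`-fold MDS code. -/
def IsMDSCode {k n : ℕ} (M : Set (Cube k n)) : Prop :=
  IsMultipleMDSCode 1 M

/-- `B` is a latin bitrade: every one-dimensional face meets it in `0` or `2` vertices. -/
def IsLatinBitrade {k n : ℕ} (B : Set (Cube k n)) : Prop :=
  ∀ (a : Cube k n) (i : Fin n), (B ∩ oneFace a i).ncard = 0 ∨ (B ∩ oneFace a i).ncard = 2

/-- The graph of minimal distances of `Q_k^n`: two vertices are adjacent iff they differ in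
exactly one position. -/
def minDistGraph (k n : ℕ) : SimpleGraph (Cube k n) where
  Adj x y := hammingDist x y = 1
  symm := ⟨fun x y h => by rwa [hammingDist_comm]⟩
  loopless := ⟨fun x h => by simp at h⟩

/-- A latin bitrade is bipartite if it induces a bipartite subgraph of the graph of minimal
distances. -/
def IsBipartiteLatinBitrade {k n : ℕ} (B : Set (Cube k n)) : Prop :=
  IsLatinBitrade B ∧ ((minDistGraph k n).induce B).IsBipartite

/-- The latin bitrade `B` is embedded in the `t`-fold MDS code `M`: `B` is the symmetric
difference of `M` and another `t`-fold MDS code. -/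
def EmbedsInMultipleMDSCode {k n : ℕ} (t : ℕ) (B M : Set (Cube k n)) : Prop :=
  IsLatinBitrade B ∧ IsMultipleMDSCode t M ∧
    ∃ M' : Set (Cube k n), IsMultipleMDSCode t M' ∧ B = M ∆ M'

/-- The inclusion `Q_k^n ⊆ Q_m^n` for `k ≤ m`. -/
def inclusion {k m : ℕ} (n : ℕ) (h : k ≤ m) (x : Cube k n) : Cube m n :=
  fun i => Fin.castLE h (x i)

end LatinBitrade

namespace LatinBitrade

open Function

/-! ### Switching a linear code over an elementary abelian 2-group. -/

section Switching

variable {n k : ℕ}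

/-! A colour class `P` of `B` has no two points at distance 1, and it suffices to extend `P` to an
MDS code `M`. Indeed, a line meeting `B` meets it in two points of different colours, exactly one of
them in `P ⊆ M`, so `M ∆ B` is again an MDS code.

To extend `P`, send letters to independent generators of a 2-group. A vertex `p` then has coordinate
sum `s = letterSum p ≠ 0`, hence lies off the code `∑ x i = 0`. On the subcube through `p` with
every coordinate free to move by `s`, sums are only `0` or `s`, and a step by `s` exchanges them, so
complementing the code there keeps one point per line and captures `p`. Subcubes of points of `P`
are disjoint (`eq_of_mem_switchCube`), so all switches can be made at once
(`switchedCode_existsUnique`). -/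

/-- The elementary abelian 2-group freely generated by the pairs (position, letter). -/
abbrev LetterGroup (n k : ℕ) : Type := Fin n × Fin k → ZMod 2

/-- The generator attached to the letter `a` in position `i`. -/
def letter (i : Fin n) (a : Fin k) : LetterGroup n k := Pi.single (i, a) 1

/-- The sum of the generators attached to the letters of a vertex. -/
def letterSum (p : Cube k n) : LetterGroup n k := ∑ i, letter i (p i)

/-- The two-element-wide subcube in directions `letterSum p` through the image of `p`. -/
def switchCube (p : Cube k n) : Set (Fin n → LetterGroup n k) :=
  {x | ∀ i, x i = letter i (p i) ∨ x i = letter i (p i) + letterSum p}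

/-- The linear code `∑ x i = 0`, switched on the subcubes attached to the points of `P`. -/
def switchedCode (P : Set (Cube k n)) : Set (Fin n → LetterGroup n k) :=
  {x | (∑ i, x i = 0 ∧ ∀ p ∈ P, x ∉ switchCube p) ∨
    (∑ i, x i ≠ 0 ∧ ∃ p ∈ P, x ∈ switchCube p)}

lemma letter_apply (i : Fin n) (a : Fin k) (j : Fin n) (b : Fin k) :
    letter i a (j, b) = if j = i ∧ b = a then 1 else 0 := by
  simp [letter, Pi.single_apply]

lemma letterSum_apply (p : Cube k n) (j : Fin n) (b : Fin k) :
    letterSum p (j, b) = if b = p j then 1 else 0 := by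
  simp only [letterSum, Finset.sum_apply, letter_apply]
  rw [Finset.sum_eq_single j] <;> simp +contextual [eq_comm]

lemma letter_injective (i : Fin n) : Injective (letter i : Fin k → LetterGroup n k) := by
  intro a b h
  by_contra hab
  have := congrFun h (i, a)
  simp [letter_apply, hab] at this

lemma letterSum_ne_zero (p : Cube k n) (i : Fin n) : letterSum p ≠ 0 := by
  intro h
  have := congrFun h (i, p i)
  simp [letterSum_apply] at this

lemma letterGroup_add_self (g : LetterGroup n k) : g + g = 0 := by
  funext x
  exact CharTwo.add_self_eq_zero _

/-- Each coordinate deviates from its letter by `0` or `letterSum p`; by 2-torsion so does the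
total. -/
lemma sum_of_mem_switchCube {p : Cube k n} {x : Fin n → LetterGroup n k}
    (hx : x ∈ switchCube p) : ∑ i, x i = 0 ∨ ∑ i, x i = letterSum p := by
  have key : ∀ s : Finset (Fin n), ∑ i ∈ s, (x i + letter i (p i)) = 0 ∨
      ∑ i ∈ s, (x i + letter i (p i)) = letterSum p := by
    intro s
    induction s using Finset.induction_on with
    | empty => simp
    | insert i s hi ih =>
      rw [Finset.sum_insert hi]
      have hxi : x i + letter i (p i) = 0 ∨ x i + letter i (p i) = letterSum p := by
        rcases hx i with h | h
        · left; rw [h, letterGroup_add_self]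
        · right; rw [h, add_right_comm, letterGroup_add_self, zero_add]
      rcases hxi with h | h <;> rcases ih with h' | h' <;> simp [h, h', letterGroup_add_self]
  have h := key Finset.univ
  rw [Finset.sum_add_distrib] at h
  change _ + letterSum p = 0 ∨ _ + letterSum p = letterSum p at h
  rcases h with h | h
  · right
    calc ∑ i, x i = ∑ i, x i + letterSum p + letterSum p := by
          rw [add_assoc, letterGroup_add_self, add_zero]
      _ = letterSum p := by rw [h, zero_add]
  · left; simpa using h

lemma sum_update_add (x : Fin n → LetterGroup n k) (i : Fin n) (g : LetterGroup n k) :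
    ∑ j, update x i (x i + g) j = ∑ j, x j + g := by
  rw [Finset.sum_update_of_mem (Finset.mem_univ i),
    ← Finset.add_sum_erase Finset.univ x (Finset.mem_univ i), Finset.sdiff_singleton_eq_erase]
  abel

lemma update_mem_switchCube {p : Cube k n} {x : Fin n → LetterGroup n k}
    (hx : x ∈ switchCube p) (i : Fin n) :
    update x i (x i + letterSum p) ∈ switchCube p := by
  intro j
  rcases eq_or_ne j i with rfl | hj
  · rw [update_self]
    rcases hx j with h | h
    · right; rw [h]
    · left; rw [h, add_assoc, letterGroup_add_self, add_zero]
  · rw [update_of_ne hj]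
    exact hx j

lemma exists_ne_of_hammingDist_ne_one {p q : Cube k n} (h : hammingDist p q ≠ 1) {i : Fin n}
    (hi : p i ≠ q i) : ∃ j, j ≠ i ∧ p j ≠ q j := by
  by_contra! hc
  apply h
  rw [hammingDist, Finset.card_eq_one]
  refine ⟨i, Finset.ext fun j => ?_⟩
  simp only [Finset.mem_filter, Finset.mem_univ, true_and, Finset.mem_singleton]
  exact ⟨fun hj => by_contra fun hji => hj (hc j hji), fun hj => hj ▸ hi⟩

/-- Subcubes attached to distinct vertices at distance at least two are disjoint. -/
lemma eq_of_mem_switchCube {p q : Cube k n} (h : hammingDist p q ≠ 1)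
    {x : Fin n → LetterGroup n k} (hp : x ∈ switchCube p) (hq : x ∈ switchCube q) : p = q := by
  by_contra hpq
  obtain ⟨i, hi⟩ := Function.ne_iff.1 hpq
  obtain ⟨j, hji, hj⟩ := exists_ne_of_hammingDist_ne_one h hi
  rcases hp i with h1 | h1 <;> rcases hq i with h2 | h2 <;> rw [h1] at h2
  · exact hi (letter_injective i h2)
  · have := congrFun h2 (i, p i)
    simp [letter_apply, letterSum_apply, hi] at this
  · have := congrFun h2 (i, q i)
    simp [letter_apply, letterSum_apply, hi.symm] at this
  -- Both shifts occur at `i`; a second differing position `j` tells the shifts apart, since the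
  -- letters at `i` vanish there.
  · have := congrFun h2 (j, p j)
    simp [letter_apply, letterSum_apply, hji, hj] at this

/-- The index `i` witnesses `n > 0`, without which `letterSum p` would be zero. -/
lemma image_mem_switchedCode {P : Set (Cube k n)} (i : Fin n) {p : Cube k n} (hp : p ∈ P) :
    (fun j => letter j (p j)) ∈ switchedCode P :=
  Or.inr ⟨letterSum_ne_zero p i, p, hp, fun _ => Or.inl rfl⟩

lemma switchedCode_existsUnique {P : Set (Cube k n)}
    (hP : ∀ p ∈ P, ∀ q ∈ P, hammingDist p q ≠ 1) (a : Fin n → LetterGroup n k) (i : Fin n) :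
    ∃! v, update a i v ∈ switchedCode P := by
  obtain ⟨z, hz⟩ : ∃ z, ∑ j, update a i z j = 0 :=
    ⟨a i + -∑ j, a j, by rw [sum_update_add, add_neg_cancel]⟩
  have hsum : ∀ g, ∑ j, update a i (z + g) j = g := by
    intro g
    have := sum_update_add (update a i z) i g
    rwa [update_self, update_idem, hz, zero_add] at this
  -- A switched-in point is one step by `letterSum p` from the zero-sum point of its line, within
  -- the same subcube.
  have hback : ∀ v, ∑ j, update a i v j ≠ 0 → ∀ p, update a i v ∈ switchCube p →
      v = z + letterSum p ∧ update a i z ∈ switchCube p := by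
    intro v hv p hp
    have hvz : v = z + (-z + v) := by abel
    have hs : v = z + letterSum p := by
      have h := (sum_of_mem_switchCube hp).resolve_left hv
      rw [hvz, hsum] at h
      rw [← h]; exact hvz
    refine ⟨hs, ?_⟩
    have := update_mem_switchCube hp i
    rwa [update_self, update_idem, hs, add_assoc, letterGroup_add_self, add_zero] at this
  have hzero : ∀ v, ∑ j, update a i v j = 0 → v = z := by
    intro v hv
    have hvz : v = z + (-z + v) := by abel
    rw [hvz, hsum] at hv
    rw [hvz, hv, add_zero]
  by_cases hc : ∃ p ∈ P, update a i z ∈ switchCube p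
  · obtain ⟨p, hp, hzp⟩ := hc
    refine ⟨z + letterSum p, Or.inr ⟨by rw [hsum]; exact letterSum_ne_zero p i, p, hp, ?_⟩, ?_⟩
    · have := update_mem_switchCube hzp i
      rwa [update_self, update_idem] at this
    · rintro v (⟨hv, hvP⟩ | ⟨hv, q, hq, hvq⟩)
      · exact absurd hzp (hzero v hv ▸ hvP p hp)
      · obtain ⟨h1, h2⟩ := hback v hv q hvq
        rw [h1, eq_of_mem_switchCube (hP p hp q hq) hzp h2]
  · refine ⟨z, Or.inl ⟨hz, fun p hp h => hc ⟨p, hp, h⟩⟩, ?_⟩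
    rintro v (⟨hv, -⟩ | ⟨hv, q, hq, hvq⟩)
    · exact hzero v hv
    · exact absurd ⟨q, hq, (hback v hv q hvq).2⟩ hc

end Switching

/-! ### Transfer to the alphabet `Fin m`. -/

lemma ncard_inter_oneFace {k n : ℕ} (M : Set (Cube k n)) (a : Cube k n) (i : Fin n) :
    (M ∩ oneFace a i).ncard = {v | update a i v ∈ M}.ncard := by
  rw [← Set.ncard_image_of_injective _ (update_injective a i)]
  congr 1
  ext x
  simp only [oneFace, Set.mem_inter_iff, Set.mem_range, Set.mem_image, Set.mem_ofPred_eq]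
  constructor
  · rintro ⟨hx, v, rfl⟩
    exact ⟨v, hx, rfl⟩
  · rintro ⟨v, hv, rfl⟩
    exact ⟨hv, v, rfl⟩

lemma isMDSCode_iff {k n : ℕ} {M : Set (Cube k n)} :
    IsMDSCode M ↔ ∀ a i, ∃! v, update a i v ∈ M := by
  simp only [IsMDSCode, IsMultipleMDSCode, ncard_inter_oneFace, Set.ncard_eq_one,
    Set.eq_singleton_iff_unique_mem]
  rfl

/-- An injection of `Fin k` into a finite type extends to an enumeration of that type. -/
lemma exists_equiv_extend {k m : ℕ} {α : Type*} [Fintype α] (hm : Fintype.card α = m)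
    (h : k ≤ m) (f : Fin k → α) (hf : Injective f) :
    ∃ e : Fin m ≃ α, ∀ a, e (Fin.castLE h a) = f a := by
  classical
  -- The default value of the extension needs a letter to exist.
  rcases isEmpty_or_nonempty (Fin k) with hk | ⟨⟨a₀⟩⟩
  · exact ⟨(Fintype.equivFinOfCardEq hm).symm, fun a => hk.elim a⟩
  have hext : ∀ a, extend (Fin.castLE h) f (fun _ => f a₀) (Fin.castLE h a) = f a :=
    (Fin.castLE_injective h).extend_apply f _
  obtain ⟨g, hg⟩ := Finset.exists_equiv_extend_of_card_eq (α := Fin m) (t := Finset.univ)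
    (s := Finset.univ.image (Fin.castLE h)) (f := extend (Fin.castLE h) f (fun _ => f a₀))
    (by simp [hm]) (Finset.subset_univ _) (by
      intro x hx y hy hxy
      simp only [Finset.coe_image, Finset.coe_univ, Set.image_univ, Set.mem_range] at hx hy
      obtain ⟨a, rfl⟩ := hx
      obtain ⟨b, rfl⟩ := hy
      rw [hext, hext] at hxy
      rw [hf hxy])
  refine ⟨g.trans (Equiv.subtypeUnivEquiv Finset.mem_univ), fun a => ?_⟩
  rw [← hext a, ← hg _ (Finset.mem_image_of_mem _ (Finset.mem_univ a))]
  rfl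

/-- Every partial code with distance two extends to an MDS code over a larger alphabet. -/
theorem exists_isMDSCode_superset {k n : ℕ} (P : Set (Cube k n))
    (hP : ∀ p ∈ P, ∀ q ∈ P, hammingDist p q ≠ 1) :
    ∃ (m : ℕ) (h : k ≤ m) (M : Set (Cube m n)), IsMDSCode M ∧ inclusion n h '' P ⊆ M := by
  rcases Nat.eq_zero_or_pos n with rfl | hn
  · exact ⟨k, le_rfl, Set.univ, fun _ i => i.elim0, Set.subset_univ _⟩
  let i₀ : Fin n := ⟨0, hn⟩
  have h : k ≤ Fintype.card (LetterGroup n k) := by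
    simpa using Fintype.card_le_of_injective _ (letter_injective (k := k) i₀)
  -- Relabelling each coordinate separately preserves the MDS property.
  choose e he using fun i : Fin n => exists_equiv_extend rfl h (letter i) (letter_injective i)
  refine ⟨_, h, {x | (fun i => e i (x i)) ∈ switchedCode P}, isMDSCode_iff.2 fun a i => ?_, ?_⟩
  · have hupd : ∀ v, (fun j => e j (update a i v j)) = update (fun j => e j (a j)) i (e i v) := by
      intro v
      funext j
      exact apply_update (fun j => e j) a i v j
    obtain ⟨v, hv, huniq⟩ := switchedCode_existsUnique hP (fun j => e j (a j)) i
    refine ⟨(e i).symm v, ?_, fun w hw => ?_⟩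
    · simp only [Set.mem_ofPred_eq, hupd, Equiv.apply_symm_apply]
      exact hv
    · simp only [Set.mem_ofPred_eq, hupd] at hw
      rw [← huniq _ hw, Equiv.symm_apply_apply]
  · rintro _ ⟨p, hp, rfl⟩
    simp only [Set.mem_ofPred_eq, inclusion, he]
    exact image_mem_switchedCode i₀ hp

/-! ### Lines through the included bitrade, and switching along it. -/

lemma inclusion_injective {k m : ℕ} (n : ℕ) (h : k ≤ m) : Injective (inclusion n h) := by
  intro x y hxy
  funext i
  exact Fin.castLE_injective h (congrFun hxy i)

lemma inclusion_update {k m n : ℕ} (h : k ≤ m) (b : Cube k n) (i : Fin n) (w : Fin k) :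
    inclusion n h (update b i w) = update (inclusion n h b) i (Fin.castLE h w) := by
  funext j
  exact apply_update (fun _ => Fin.castLE h) b i w j

/-- The trace of an included set on a line is empty or is the included trace of a line. -/
lemma line_inclusion_image {k m n : ℕ} (h : k ≤ m) (B : Set (Cube k n)) (a : Cube m n)
    (i : Fin n) :
    {v | update a i v ∈ inclusion n h '' B} = ∅ ∨ ∃ b ∈ B,
      (∀ w, update a i (Fin.castLE h w) = inclusion n h (update b i w)) ∧
      {v | update a i v ∈ inclusion n h '' B} = Fin.castLE h '' {w | update b i w ∈ B} := by
  rcases Set.eq_empty_or_nonempty {v | update a i v ∈ inclusion n h '' B} with h0 | ⟨v, b, hb, hv⟩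
  · exact Or.inl h0
  right
  have hline : ∀ w, update a i w = update (inclusion n h b) i w := by
    intro w; rw [hv, update_idem]
  refine ⟨b, hb, fun w => by rw [hline, inclusion_update], Set.ext fun w => ⟨?_, ?_⟩⟩
  · rintro ⟨c, hc, hcw⟩
    rw [hline] at hcw
    have hw : w = Fin.castLE h (c i) := by
      have := congrFun hcw i
      rw [update_self] at this
      exact this.symm
    refine ⟨c i, ?_, hw.symm⟩
    rw [hw, ← inclusion_update] at hcw
    rw [Set.mem_ofPred_eq, ← inclusion_injective n h hcw]
    exact hc
  · rintro ⟨w, hw, rfl⟩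
    exact ⟨_, hw, by rw [hline, inclusion_update]⟩

lemma isLatinBitrade_inclusion_image {k m n : ℕ} (h : k ≤ m) {B : Set (Cube k n)}
    (hB : IsLatinBitrade B) : IsLatinBitrade (inclusion n h '' B) := by
  intro a i
  rw [ncard_inter_oneFace]
  rcases line_inclusion_image h B a i with h0 | ⟨b, -, -, hb⟩
  · left; rw [h0, Set.ncard_empty]
  · rw [hb, Set.ncard_image_of_injective _ (Fin.castLE_injective h), ← ncard_inter_oneFace]
    exact hB b i

lemma hammingDist_update_update {k n : ℕ} (b : Cube k n) (i : Fin n) {u v : Fin k} (h : u ≠ v) :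
    hammingDist (update b i u) (update b i v) = 1 := by
  rw [hammingDist, Finset.card_eq_one]
  refine ⟨i, Finset.ext fun j => ?_⟩
  rcases eq_or_ne j i with rfl | hj <;> simp [*]

/-- Switching an MDS code along a bitrade that meets it in one element of each line it meets. -/
lemma isMDSCode_symmDiff {k n : ℕ} {M B : Set (Cube k n)} (hM : IsMDSCode M)
    (h : ∀ a i, {v | update a i v ∈ B} = ∅ ∨
      ∃ u v, u ≠ v ∧ {w | update a i w ∈ B} = {u, v} ∧ update a i u ∈ M) :
    IsMDSCode (M ∆ B) := by
  rw [isMDSCode_iff] at hM ⊢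
  intro a i
  obtain ⟨x, hx, huniq⟩ := hM a i
  rcases h a i with h0 | ⟨u, v, huv, hB, hu⟩
  · have hnot : ∀ w, update a i w ∉ B := fun w hw => (Set.ext_iff.1 h0 w).1 hw
    simpa [Set.mem_symmDiff, hnot] using hM a i
  · have hmemB : ∀ w, update a i w ∈ B ↔ w = u ∨ w = v := fun w => Set.ext_iff.1 hB w
    have hmemM : ∀ w, update a i w ∈ M ↔ w = u := fun w =>
      ⟨fun hw => (huniq w hw).trans (huniq u hu).symm, fun hw => hw ▸ hu⟩
    refine ⟨v, Or.inr ⟨(hmemB v).2 (Or.inr rfl), fun hv => huv ((hmemM v).1 hv).symm⟩, ?_⟩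
    rintro w (⟨h1, h2⟩ | ⟨h1, h2⟩)
    · exact absurd ((hmemB w).2 (Or.inl ((hmemM w).1 h1))) h2
    · exact ((hmemB w).1 h1).resolve_left fun h => h2 ((hmemM w).2 h)

end LatinBitrade

open LatinBitrade Function

theorem proposition8 (k n : ℕ) (B : Set (LatinBitrade.Cube k n))
    (hB : LatinBitrade.IsBipartiteLatinBitrade B) :
    ∃ (m : ℕ) (h : k ≤ m) (M : Set (LatinBitrade.Cube m n)),
      LatinBitrade.IsMDSCode M ∧
        LatinBitrade.EmbedsInMultipleMDSCode 1 (LatinBitrade.inclusion n h '' B) M := by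
  obtain ⟨hB, ⟨c⟩⟩ := hB
  have hc : ∀ x y (hx : x ∈ B) (hy : y ∈ B), hammingDist x y = 1 → c ⟨x, hx⟩ ≠ c ⟨y, hy⟩ :=
    fun x y hx hy hxy => c.valid (v := ⟨x, hx⟩) (w := ⟨y, hy⟩) hxy
  obtain ⟨m, h, M, hM, hsub⟩ := exists_isMDSCode_superset {x | ∃ hx : x ∈ B, c ⟨x, hx⟩ = 0} (by
    rintro p ⟨hp, hp0⟩ q ⟨hq, hq0⟩ hpq
    exact hc p q hp hq hpq (hp0.trans hq0.symm))
  refine ⟨m, h, M, hM, isLatinBitrade_inclusion_image h hB, hM, M ∆ (inclusion n h '' B),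
    isMDSCode_symmDiff hM fun a i => ?_, (symmDiff_symmDiff_cancel_left _ _).symm⟩
  rcases line_inclusion_image h B a i with h0 | ⟨b, hb, hline, himg⟩
  · exact Or.inl h0
  right
  have hmem : b i ∈ {w | update b i w ∈ B} := by simpa using hb
  have hcard : {w | update b i w ∈ B}.ncard = 2 := by
    have := hB b i
    rw [ncard_inter_oneFace] at this
    exact this.resolve_left ((Set.ncard_pos (Set.toFinite _)).2 ⟨_, hmem⟩).ne'
  obtain ⟨u, v, huv, hpair⟩ := Set.ncard_eq_two.1 hcard
  have hu : update b i u ∈ B := (Set.ext_iff.1 hpair u).2 (Or.inl rfl)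
  have hv : update b i v ∈ B := (Set.ext_iff.1 hpair v).2 (Or.inr rfl)
  have hcol := hc _ _ hu hv (hammingDist_update_update b i huv)
  rw [hpair, Set.image_pair] at himg
  -- The endpoint of colour 0 is the one lying in `M`.
  by_cases hu0 : c ⟨_, hu⟩ = 0
  · exact ⟨_, _, (Fin.castLE_injective h).ne huv, himg, hline u ▸ hsub ⟨_, ⟨hu, hu0⟩, rfl⟩⟩
  · have hv0 : c ⟨_, hv⟩ = 0 := by omega
    exact ⟨_, _, (Fin.castLE_injective h).ne huv.symm, himg.trans (Set.pair_comm _ _),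
      hline v ▸ hsub ⟨_, ⟨hv, hv0⟩, rfl⟩⟩
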